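/- \textbf{Setting.} Fix sets of attributes, of relation names and of constants; each relation name $R$ has a finite set $\mathrm{Att}(R)$ of attributes. The constants include the natural numbers. A \emph{schema} $\mathbf S$ is a finite set of relation names. For a commutative monoid $\mathbb K=(K,\oplus,0)$ with natural preorder $a\le b\iff\exists c:\,a\oplus c=b$, a \emph{$\mathbb K$-database} $\mathfrak D$ over $\mathbf S$ assigns to each $R\in\mathbf S$ a finitely supported function $R^{\mathfrak D}$ from the tuples $t:\mathrm{Att}(R)\to\mathrm{Const}$ to $K$. For pairwise distinct $A_1,\dots,A_n\in\mathrm{Att}(R)$ put $R^{\mathfrak D}[A_1,\dots,A_n](\vec a)=\bigoplus\{R^{\mathfrak D}(t): t(A_i)=a_i\text{ for all }i\}$. An \emph{inclusion dependency} (IND) is an expression $\sigma=R[A_1,\dots,A_n]\le S[B_1,\dots,B_n]$ ($n\ge 0$) with pairwise distinct $A_i\in\mathrm{Att}(R)$ and pairwise distinct $B_i\in\mathrm{Att}(S)$; $\mathfrak D\models\sigma$ means $R^{\mathfrak D}[\vec A](\vec a)\le S^{\mathfrak D}[\vec B](\vec a)$ for all $\vec a\in\mathrm{Const}^n$. $\Sigma\models_{\mathbb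 K}\tau$ means that every $\mathbb K$-database (over any schema containing the relation names of $\Sigma$ and $\tau$) that satisfies $\Sigma$ satisfies $\tau$. $\Sigma\vdash_{\rm ws}\tau$ means that $\tau$ is derivable from $\Sigma$ by: reflexivity ($R[\vec A]\le R[\vec A]$); transitivity (from $R[\vec A]\le S[\vec B]$ and $S[\vec B]\le T[\vec C]$ infer $R[\vec A]\le T[\vec C]$); projection and permutation (from $R[A_1,\dots,A_n]\le S[B_1,\dots,B_n]$ infer $R[A_{i_1},\dots,A_{i_\ell}]\le S[B_{i_1},\dots,B_{i_\ell}]$ for distinct $i_1,\dots,i_\ell\in\{1,\dots,n\}$); and weak symmetry (from $R[\vec A]\le S[\vec B]$ and $S[\emptyset]\le R[\emptyset]$ infer $S[\vec B]\le R[\vec A]$). Let $\Sigma^{\rm ws}=\{\sigma:\Sigma\vdash_{\rm ws}\sigma\}$. Fix a constant $*$. \emph{$\oplus$-chase}: for $\sigma=R[\vec A]\le S[\vec B]$ and $\vec a$ with $R^{\mathfrak D}[\vec A](\vec a)\not\le S^{\mathfrak D}[\vec B](\vec a)$, the chase step $\mathfrak D\to_{\sigma,\vec a}\mathfrak D'$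 adds the element $c$ with $S^{\mathfrak D}[\vec B](\vec a)\oplus c=R^{\mathfrak D}[\vec A](\vec a)$ to the weight in $S$ of the tuple $t'$ given by $t'(\vec B)=\vec a$ and $t'(C)=*$ for all other attributes $C$, and changes nothing else. A chase sequence from $\mathfrak D$ by a set $\Gamma$ of INDs is a sequence starting with $\mathfrak D$ in which each member arises from the previous one by a chase step with respect to some $\sigma\in\Gamma$, and which is either finite with last member satisfying $\Gamma$ (this member is called a \emph{result} of the chase), or infinite and such that for all $i$, all $R[\vec A]\le S[\vec B]$ in $\Gamma$ and all $\vec a$ there is $j>i$ with $R^{\mathfrak D_i}[\vec A](\vec a)\le S^{\mathfrak D_j}[\vec B](\vec a)$. The chase \emph{terminates} if there is no infinite chase sequence. For $\tau=R[A_1,\dots,A_n]\le S[B_1,\dots,B_n]$, where $*\notin\{1,\dots,n\}$, let $\mathfrak D_\tau$ be the $\mathbb N$-database in which the $R$-tuple $t$ with $t(A_i)=i$ and $t(C)=*$ for all other $C\in\mathrm{Att}(R)$ has weight $1$, and all other tuples of all relations have weight $0$. \textbf{Theorem.} Let $\mathbb K$ be a commutative monoid that is non-trivial ($|K|>1$),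 positive ($a\oplus b=0$ implies $a=b=0$) and weakly cancellative ($a\oplus b=b$ implies $a=0$). Let $\Sigma\cup\{\tau\}$ be a finite set of INDs and $\mathbf S$ a schema containing all of their relation names; consider $\mathfrak D_\tau$ as an $\mathbb N$-database over $\mathbf S$. Then the $\oplus$-chase of $\mathfrak D_\tau$ by $\Sigma^{\rm ws}$ terminates and has at least one result, and for every result $\mathfrak E$ of this chase the following are equivalent: (1) $\Sigma\vdash_{\rm ws}\tau$; (2) $\Sigma\models_{\mathbb K}\tau$; (3) $\mathfrak E\models\tau$. -/

import Mathlib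

/-! ### Monoids -/

/-- The natural (pre)order of a commutative monoid: `a ≤ b` iff `a ⊕ c = b` for some `c`. -/
def NatLE {K : Type*} [AddCommMonoid K] (a b : K) : Prop := ∃ c, a + c = b

/-- A monoid is positive if `a ⊕ b = 0` entails `a = 0 = b`. -/
def PositiveMonoid (K : Type*) [AddCommMonoid K] : Prop :=
  ∀ a b : K, a + b = 0 → a = 0 ∧ b = 0

/-- A monoid is weakly cancellative if `a ⊕ b = b` entails `a = 0`. -/
def WeaklyCancellative (K : Type*) [AddCommMonoid K] : Prop :=
  ∀ a b : K, a + b = b → a = 0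

/-! ### `K`-relations and `K`-databases

`Attr`, `Const`, `Rel` are the types of attributes, constants and relation names, and
`att R` is the finite set of attributes of the relation name `R`. -/

/-- Tuples over a finite set `X` of attributes. -/
abbrev Tup {Attr : Type*} (Const : Type*) (X : Finset Attr) : Type _ :=
  {x : Attr // x ∈ X} → Const

/-- A `K`-relation over `X`: a finitely supported function from tuples over `X` to `K`. -/
abbrev KRelation {Attr : Type*} (K Const : Type*) [AddCommMonoid K] (X : Finset Attr) : Type _ :=
  Tup Const X →₀ K

/-- The marginal `R[A₁, …, Aₙ](a₁, …, aₙ)`: the sum of the weights `R(t)` over all tuples `t` with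
`t(Aᵢ) = aᵢ` for all `i` (`Finsupp.mapDomain` is the push-forward of weights, here along the
projection `t ↦ (t(A₁), …, t(Aₙ))`). -/
noncomputable def marg {Attr K Const : Type*} [AddCommMonoid K] {X : Finset Attr} {n : ℕ}
    (f : KRelation K Const X) (A : Fin n ↪ {x : Attr // x ∈ X}) (a : Fin n → Const) : K :=
  Finsupp.mapDomain (fun (t : Tup Const X) (i : Fin n) => t (A i)) f a

/-- A `K`-database over the schema `Sch` (a finite set of relation names): a `K`-relation over
`att R` for each `R ∈ Sch`. For names outside of `Sch`, where a database has no relation, `rel` takes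
the default value `0`, so that a database is determined by its relations on `Sch`. -/
structure KDatabase {Attr Rel : Type*} (K Const : Type*) [AddCommMonoid K]
    (att : Rel → Finset Attr) (Sch : Finset Rel) where
  rel : (R : Rel) → KRelation K Const (att R)
  rel_eq_zero : ∀ R, R ∉ Sch → rel R = 0

/-! ### Inclusion dependencies -/

/-- An inclusion dependency `lhs[A₁, …, Aₙ] ≤ rhs[B₁, …, Bₙ]`, where `n` is the arity (possibly
zero) and `A`, `B` are sequences of pairwise distinct attributes of `lhs` and `rhs`. -/
structure IND {Attr Rel : Type*} (att : Rel → Finset Attr) where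
  lhs : Rel
  rhs : Rel
  arity : ℕ
  A : Fin arity ↪ {x : Attr // x ∈ att lhs}
  B : Fin arity ↪ {x : Attr // x ∈ att rhs}

/-- Both relation names of `σ` belong to the schema `Sch`. -/
def IND.Over {Attr Rel : Type*} {att : Rel → Finset Attr} (σ : IND att) (Sch : Finset Rel) : Prop :=
  σ.lhs ∈ Sch ∧ σ.rhs ∈ Sch

/-- `D ⊨ σ`. -/
def KDatabase.Satisfies {Attr Rel K Const : Type*} [AddCommMonoid K] {att : Rel → Finset Attr}
    {Sch : Finset Rel} (D : KDatabase K Const att Sch) (σ : IND att) : Prop :=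
  ∀ a : Fin σ.arity → Const, NatLE (marg (D.rel σ.lhs) σ.A a) (marg (D.rel σ.rhs) σ.B a)

/-- `Γ` entails `τ` over `K`-databases: every `K`-database, over any schema that contains the
relation names of `Γ` and `τ`, satisfies `τ` whenever it satisfies `Γ`. -/
def Entails {Attr Rel : Type*} (K Const : Type*) [AddCommMonoid K] {att : Rel → Finset Attr}
    (Γ : Set (IND att)) (τ : IND att) : Prop :=
  ∀ Sch : Finset Rel, (∀ σ ∈ Γ, σ.Over Sch) → τ.Over Sch →
    ∀ D : KDatabase K Const att Sch, (∀ σ ∈ Γ, D.Satisfies σ) → D.Satisfies τ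

/-- Derivability from `Γ` by reflexivity, transitivity, projection and permutation, and weak
symmetry (from `R[A] ≤ S[B]` and `S[∅] ≤ R[∅]` infer `S[B] ≤ R[A]`). -/
inductive DerivesWS {Attr Rel : Type*} {att : Rel → Finset Attr} (Γ : Set (IND att)) :
    IND att → Prop
  | hyp {σ : IND att} : σ ∈ Γ → DerivesWS Γ σ
  | refl (R : Rel) (n : ℕ) (A : Fin n ↪ {x : Attr // x ∈ att R}) : DerivesWS Γ ⟨R, R, n, A, A⟩
  | trans {R S T : Rel} {n : ℕ} {A : Fin n ↪ {x : Attr // x ∈ att R}}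
      {B : Fin n ↪ {x : Attr // x ∈ att S}} {C : Fin n ↪ {x : Attr // x ∈ att T}} :
      DerivesWS Γ ⟨R, S, n, A, B⟩ → DerivesWS Γ ⟨S, T, n, B, C⟩ → DerivesWS Γ ⟨R, T, n, A, C⟩
  | proj {R S : Rel} {n : ℕ} {A : Fin n ↪ {x : Attr // x ∈ att R}}
      {B : Fin n ↪ {x : Attr // x ∈ att S}} (l : ℕ) (i : Fin l ↪ Fin n) :
      DerivesWS Γ ⟨R, S, n, A, B⟩ → DerivesWS Γ ⟨R, S, l, i.trans A, i.trans B⟩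
  | weakSymm {R S : Rel} {n : ℕ} {A : Fin n ↪ {x : Attr // x ∈ att R}}
      {B : Fin n ↪ {x : Attr // x ∈ att S}} :
      DerivesWS Γ ⟨R, S, n, A, B⟩ →
      DerivesWS Γ ⟨S, R, 0, Function.Embedding.ofIsEmpty, Function.Embedding.ofIsEmpty⟩ →
      DerivesWS Γ ⟨S, R, n, B, A⟩

/-- The closure of `Γ` under the standard rules and weak symmetry. -/
def wsClosure {Attr Rel : Type*} {att : Rel → Finset Attr} (Γ : Set (IND att)) : Set (IND att) :=
  {σ | DerivesWS Γ σ}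

/-! ### The `⊕`-chase -/

/-- The tuple `t` with `t(Bᵢ) = aᵢ` for all `i`, and `t(C) = star` for all other attributes. -/
noncomputable def padTuple {Attr Const : Type*} {X : Finset Attr} {n : ℕ} (star : Const)
    (B : Fin n ↪ {x : Attr // x ∈ X}) (a : Fin n → Const) : Tup Const X :=
  Function.extend B a (fun _ => star)

/-- One step of the `⊕`-chase with respect to `σ = R[A] ≤ S[B]` and `a`: it applies if
`R[A](a) ≰ S[B](a)`, and it adds the difference `c`, i.e. the element with
`S[B](a) ⊕ c = R[A](a)`, to the weight of the padded tuple of `a` in `S`; everything else is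
left unchanged. -/
def ChaseStep {Attr Rel K Const : Type*} [AddCommMonoid K] {att : Rel → Finset Attr}
    {Sch : Finset Rel} (star : Const) (D D' : KDatabase K Const att Sch) (σ : IND att)
    (a : Fin σ.arity → Const) : Prop :=
  ¬ NatLE (marg (D.rel σ.lhs) σ.A a) (marg (D.rel σ.rhs) σ.B a) ∧
  ∃ c : K, marg (D.rel σ.rhs) σ.B a + c = marg (D.rel σ.lhs) σ.A a ∧
    D'.rel σ.rhs = D.rel σ.rhs + Finsupp.single (padTuple star σ.B a) c ∧
    ∀ U, U ≠ σ.rhs → D'.rel U = D.rel U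

/-- An infinite `⊕`-chase sequence from `D` by `Γ`: every member results from the previous one by
a chase step with respect to some `σ ∈ Γ`, and every inequality is eventually closed. -/
structure IsInfiniteChaseSeq {Attr Rel K Const : Type*} [AddCommMonoid K] {att : Rel → Finset Attr}
    {Sch : Finset Rel} (star : Const) (Γ : Set (IND att)) (D : KDatabase K Const att Sch)
    (s : ℕ → KDatabase K Const att Sch) : Prop where
  start : s 0 = D
  step : ∀ i, ∃ σ ∈ Γ, ∃ a : Fin σ.arity → Const, ChaseStep star (s i) (s (i + 1)) σ a
  fair : ∀ i, ∀ σ ∈ Γ, ∀ a : Fin σ.arity → Const, ∃ j, i < j ∧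
    NatLE (marg ((s i).rel σ.lhs) σ.A a) (marg ((s j).rel σ.rhs) σ.B a)

/-- A finite `⊕`-chase sequence `s 0, …, s n` from `D` by `Γ`: every member results from the
previous one by a chase step with respect to some `σ ∈ Γ`, and in the last member no inequality is
left open, that is, the last member satisfies `Γ`. As chase steps are monotone, the inequalities
of all earlier members are then closed in the last one, too. -/
structure IsFiniteChaseSeq {Attr Rel K Const : Type*} [AddCommMonoid K] {att : Rel → Finset Attr}
    {Sch : Finset Rel} (star : Const) (Γ : Set (IND att)) (D : KDatabase K Const att Sch) (n : ℕ)
    (s : Fin (n + 1) → KDatabase K Const att Sch) : Prop where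
  start : s 0 = D
  step : ∀ i : Fin n, ∃ σ ∈ Γ, ∃ a : Fin σ.arity → Const,
    ChaseStep star (s i.castSucc) (s i.succ) σ a
  closed : ∀ σ ∈ Γ, (s (Fin.last n)).Satisfies σ

/-- `E` is a result of the `⊕`-chase of `D` by `Γ`: the last member of a finite chase sequence. -/
def IsChaseResult {Attr Rel K Const : Type*} [AddCommMonoid K] {att : Rel → Finset Attr}
    {Sch : Finset Rel} (star : Const) (Γ : Set (IND att)) (D E : KDatabase K Const att Sch) : Prop :=
  ∃ (n : ℕ) (s : Fin (n + 1) → KDatabase K Const att Sch),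
    IsFiniteChaseSeq star Γ D n s ∧ s (Fin.last n) = E

/-- The `⊕`-chase of `D` by `Γ` terminates: every chase sequence is finite. -/
def ChaseTerminates {Attr Rel K Const : Type*} [AddCommMonoid K] {att : Rel → Finset Attr}
    {Sch : Finset Rel} (star : Const) (Γ : Set (IND att)) (D : KDatabase K Const att Sch) : Prop :=
  ¬ ∃ s : ℕ → KDatabase K Const att Sch, IsInfiniteChaseSeq star Γ D s

open Classical in
/-- The canonical `ℕ`-database of `τ = R[A₁, …, Aₙ] ≤ S[B₁, …, Bₙ]`: the tuple `t` with
`t(Aᵢ) = i` (for `i = 1, …, n`, embedded in the constants by `num`) and `t(C) = star` otherwise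
has weight `1` in `R`; all other weights are `0`. -/
noncomputable def canonicalDB {Attr Rel Const : Type*} {att : Rel → Finset Attr} (Sch : Finset Rel)
    (num : ℕ ↪ Const) (star : Const) (τ : IND att) (hτ : τ.lhs ∈ Sch) :
    KDatabase ℕ Const att Sch where
  rel := Pi.single τ.lhs
    (Finsupp.single (padTuple star τ.A (fun i => num ((i : ℕ) + 1))) 1)
  rel_eq_zero := by
    intro R hR
    exact Pi.single_eq_of_ne (fun h => hR (by rw [h]; exact hτ)) _

/-!
Soundness of the rules is routine except for weak symmetry. If `R[A] ≤ S[B]` and `S[∅] ≤ R[∅]` hold,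
then the difference of the two sides of the first inequality has a total weight that is absorbed by
the total weight of `S`, so it vanishes in a weakly cancellative positive monoid: the inequality is
an equality (`KDatabase.Satisfies.weakSymm`).

For completeness, let `E` be a result of the chase of the canonical database of `τ`. It satisfies
`Γ`, and so does its image under `n ↦ n • k` for any `k ≠ 0`, a map that preserves and reflects the
natural order (`natLE_nsmul_iff`); hence `E` satisfies every entailed `τ`. If `E` satisfies `τ`, then
it has a tuple on the right-hand side of `τ` with the entries `1, …, n`, and following these entries
back through the chase gives a derivation of `τ` (`Traced`, `IsChaseResult.derives`).

Termination holds for the chase of every `ℕ`-database by a closed set of dependencies. The level of a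
tuple is the number of its entries other than `star`. A chase step of level `l` adds a tuple of
level `l`, so it does not affect marginals above level `l`. In an infinite chase sequence let `m` be
the largest level that occurs infinitely often. From some point on no step has a level above `m`, and
by fairness all instances above level `m` are closed. Now consider the weight of all extensions of a
tuple of level `m`, reading `star` as a wildcard. A step along a dependency `R[A] ≤ S[B]` with
`S[∅] ≤ R[∅]` derivable only copies such a weight from `R` to `S`, because by weak symmetry the
marginals above level `m` agree; along any other dependency the weight grows by at most a fixed
constant, but then `S` is strictly above `R` in the preorder of relation names. So these weights are
bounded (`weightOn_extends_bounded`), while only finitely many tuples of level `m` can occur and the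
steps of level `m` increase their total weight infinitely often, a contradiction
(`not_forall_chaseStep`). The same argument applies if fairness is replaced by the strategy to treat
violated instances of maximal level first, so that this strategy ends with a result
(`exists_isChaseResult`).
-/

/-! ### Soundness of the rules -/

theorem NatLE.refl {K : Type*} [AddCommMonoid K] (a : K) : NatLE a a := ⟨0, add_zero a⟩

theorem NatLE.trans {K : Type*} [AddCommMonoid K] {a b c : K} (h₁ : NatLE a b) (h₂ : NatLE b c) :
    NatLE a c := by
  obtain ⟨d, rfl⟩ := h₁
  obtain ⟨e, rfl⟩ := h₂
  exact ⟨d + e, (add_assoc _ _ _).symm⟩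

theorem natLE_nat {a b : ℕ} : NatLE a b ↔ a ≤ b :=
  ⟨fun ⟨_, h⟩ => h ▸ Nat.le_add_right _ _, fun h => ⟨b - a, Nat.add_sub_cancel' h⟩⟩

/-- A pointwise inequality between finitely supported functions has a finitely supported
difference. -/
theorem exists_add_eq_of_forall_natLE {K α : Type*} [AddCommMonoid K] {f g : α →₀ K}
    (h : ∀ a, NatLE (f a) (g a)) : ∃ d, f + d = g := by
  classical
  choose c hc using h
  refine ⟨Finsupp.onFinset (f.support ∪ g.support)
    (fun a => if a ∈ f.support ∪ g.support then c a else 0) (by aesop), ?_⟩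
  ext a
  by_cases ha : a ∈ f.support ∪ g.support
  · simp only [Finsupp.add_apply, Finsupp.onFinset_apply, if_pos ha, hc]
  · simp only [Finsupp.add_apply, Finsupp.onFinset_apply, if_neg ha, add_zero]
    simp only [Finset.mem_union, Finsupp.mem_support_iff, not_or, not_not] at ha
    rw [ha.1, ha.2]

theorem marg_trans {Attr K Const : Type*} [AddCommMonoid K] {X : Finset Attr} {n l : ℕ}
    (f : KRelation K Const X) (A : Fin n ↪ {x : Attr // x ∈ X}) (i : Fin l ↪ Fin n)
    (b : Fin l → Const) :
    marg f (i.trans A) b = Finsupp.mapDomain (fun (c : Fin n → Const) j => c (i j))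
      (Finsupp.mapDomain (fun (t : Tup Const X) j => t (A j)) f) b := by
  rw [← Finsupp.mapDomain_comp]
  rfl

/-- In a positive monoid, a finitely supported function of total weight `0` vanishes. -/
theorem eq_zero_of_mapDomain_const_eq_zero {K α β : Type*} [AddCommMonoid K]
    (hpos : PositiveMonoid K) {f : α →₀ K} {b : β} (h : Finsupp.mapDomain (fun _ => b) f b = 0) :
    f = 0 := by
  ext a
  rw [← Finsupp.single_add_erase a f, Finsupp.mapDomain_add, Finsupp.mapDomain_single,
    Finsupp.add_apply, Finsupp.single_eq_same] at h
  exact (hpos _ _ h).1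

theorem KDatabase.Satisfies.proj {Attr Rel K Const : Type*} [AddCommMonoid K]
    {att : Rel → Finset Attr} {Sch : Finset Rel} {D : KDatabase K Const att Sch} {R S : Rel} {n l : ℕ}
    {A : Fin n ↪ {x : Attr // x ∈ att R}} {B : Fin n ↪ {x : Attr // x ∈ att S}} (i : Fin l ↪ Fin n)
    (h : D.Satisfies ⟨R, S, n, A, B⟩) : D.Satisfies ⟨R, S, l, i.trans A, i.trans B⟩ := by
  intro b
  obtain ⟨d, hd⟩ := exists_add_eq_of_forall_natLE h
  refine ⟨Finsupp.mapDomain (fun (c : Fin n → Const) j => c (i j)) d b, ?_⟩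
  simp only [marg_trans]
  rw [← hd, Finsupp.mapDomain_add, Finsupp.add_apply]

/-- Weak symmetry is sound: a pointwise inequality between relations whose total weights satisfy
the reverse inequality has a difference of total weight `0`, so it is an equality. -/
theorem KDatabase.Satisfies.weakSymm {Attr Rel K Const : Type*} [AddCommMonoid K]
    (hpos : PositiveMonoid K) (hwc : WeaklyCancellative K) {att : Rel → Finset Attr}
    {Sch : Finset Rel} {D : KDatabase K Const att Sch} {R S : Rel} {n : ℕ}
    {A : Fin n ↪ {x : Attr // x ∈ att R}} {B : Fin n ↪ {x : Attr // x ∈ att S}}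
    (h : D.Satisfies ⟨R, S, n, A, B⟩)
    (h₀ : D.Satisfies ⟨S, R, 0, Function.Embedding.ofIsEmpty, Function.Embedding.ofIsEmpty⟩) :
    D.Satisfies ⟨S, R, n, B, A⟩ := by
  obtain ⟨d, hd⟩ := exists_add_eq_of_forall_natLE h
  obtain ⟨e, he⟩ := h₀ Fin.elim0
  have total : ∀ {T : Rel} (C : Fin n ↪ {x : Attr // x ∈ att T}),
      marg (D.rel T) Function.Embedding.ofIsEmpty Fin.elim0 =
        Finsupp.mapDomain (fun (_ : Fin n → Const) => (Fin.elim0 : Fin 0 → Const))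
          (Finsupp.mapDomain (fun (t : Tup Const (att T)) j => t (C j)) (D.rel T)) Fin.elim0 := by
    intro T C
    rw [← Finsupp.mapDomain_comp, marg]
    congr 1
    congr 1
    funext t
    exact Subsingleton.elim _ _
  simp only [total A, total B] at he
  have hz : d = 0 := by
    rw [← hd, Finsupp.mapDomain_add, Finsupp.add_apply, add_assoc, add_comm] at he
    exact eq_zero_of_mapDomain_const_eq_zero hpos (hpos _ _ (hwc _ _ he)).1
  rw [hz, add_zero] at hd
  intro a
  simp only [marg]
  rw [← hd]
  exact NatLE.refl _

theorem DerivesWS.sound {Attr Rel K Const : Type*} [AddCommMonoid K] (hpos : PositiveMonoid K)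
    (hwc : WeaklyCancellative K) {att : Rel → Finset Attr} {Γ : Set (IND att)}
    {Sch : Finset Rel} {D : KDatabase K Const att Sch} (hD : ∀ σ ∈ Γ, D.Satisfies σ)
    {τ : IND att} (h : DerivesWS Γ τ) : D.Satisfies τ := by
  induction h with
  | hyp h => exact hD _ h
  | refl R n A => exact fun a => NatLE.refl _
  | trans _ _ h₁ h₂ => exact fun a => (h₁ a).trans (h₂ a)
  | proj l i _ h => exact KDatabase.Satisfies.proj i h
  | weakSymm _ _ h h₀ => exact KDatabase.Satisfies.weakSymm hpos hwc h h₀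

/-! ### From `ℕ`-databases to `K`-databases -/

/-- The image of an `ℕ`-database under the homomorphism `n ↦ n • k`. -/
noncomputable def KDatabase.smulBy {Attr Rel K Const : Type*} [AddCommMonoid K]
    {att : Rel → Finset Attr} {Sch : Finset Rel} (D : KDatabase ℕ Const att Sch) (k : K) :
    KDatabase K Const att Sch where
  rel R := (D.rel R).mapRange (fun n => n • k) (zero_nsmul k)
  rel_eq_zero R hR := by rw [D.rel_eq_zero R hR, Finsupp.mapRange_zero]

theorem natLE_nsmul_iff {K : Type*} [AddCommMonoid K] (hpos : PositiveMonoid K)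
    (hwc : WeaklyCancellative K) {k : K} (hk : k ≠ 0) {m n : ℕ} :
    NatLE (m • k) (n • k) ↔ m ≤ n := by
  refine ⟨fun ⟨c, hc⟩ => ?_, fun h => ?_⟩
  · by_contra! hlt
    obtain ⟨d, rfl⟩ := Nat.exists_eq_add_of_lt hlt
    have h0 : (d • k + c) + k = 0 := by
      apply hwc _ (n • k)
      rw [add_nsmul, add_nsmul, one_nsmul] at hc
      calc d • k + c + k + n • k = n • k + d • k + k + c := by abel
        _ = n • k := hc
    exact hk (hpos _ _ h0).2
  · obtain ⟨d, rfl⟩ := Nat.exists_eq_add_of_le h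
    exact ⟨d • k, (add_nsmul _ _ _).symm⟩

theorem KDatabase.smulBy_satisfies_iff {Attr Rel K Const : Type*} [AddCommMonoid K]
    (hpos : PositiveMonoid K) (hwc : WeaklyCancellative K) {att : Rel → Finset Attr}
    {Sch : Finset Rel} (D : KDatabase ℕ Const att Sch) {k : K} (hk : k ≠ 0) (σ : IND att) :
    (D.smulBy k).Satisfies σ ↔ D.Satisfies σ := by
  have key : ∀ (R : Rel) {n : ℕ} (A : Fin n ↪ {x : Attr // x ∈ att R}) (a : Fin n → Const),
      marg ((D.smulBy k).rel R) A a = marg (D.rel R) A a • k := by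
    intro R n A a
    simp only [marg, KDatabase.smulBy]
    rw [Finsupp.mapDomain_mapRange _ _ _ _ (fun x y => add_nsmul k x y)]
    rfl
  unfold KDatabase.Satisfies
  simp only [key, natLE_nsmul_iff hpos hwc hk, natLE_nat]

/-! ### Weights of sets of tuples -/

open Classical in
/-- The total weight that `f` gives to the points with property `P`. -/
noncomputable def weightOn {α : Type*} (f : α →₀ ℕ) (P : α → Prop) : ℕ :=
  f.sum fun t w => if P t then w else 0

theorem weightOn_add_single {α : Type*} (f : α →₀ ℕ) (q : α) (c : ℕ) (P : α → Prop)
    [Decidable (P q)] :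
    weightOn (f + Finsupp.single q c) P = weightOn f P + if P q then c else 0 := by
  classical
  unfold weightOn
  rw [Finsupp.sum_add_index', Finsupp.sum_single_index]
  · congr
  · simp
  · simp
  · intros; split_ifs <;> simp

theorem weightOn_zero {α : Type*} (P : α → Prop) : weightOn (0 : α →₀ ℕ) P = 0 :=
  Finsupp.sum_zero_index

theorem weightOn_mapDomain {α β : Type*} (g : α → β) (f : α →₀ ℕ) (P : β → Prop) :
    weightOn (f.mapDomain g) P = weightOn f fun t => P (g t) := by
  classical
  unfold weightOn
  rw [Finsupp.sum_mapDomain_index]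
  · simp
  · intros; split_ifs <;> simp

theorem weightOn_eq {α : Type*} (f : α →₀ ℕ) (a : α) : weightOn f (· = a) = f a := by
  classical
  simp +contextual [weightOn, Finsupp.sum, Finset.sum_ite_eq']

theorem weightOn_mono {α : Type*} (f : α →₀ ℕ) {P Q : α → Prop} (h : ∀ t, P t → Q t) :
    weightOn f P ≤ weightOn f Q := by
  classical
  refine Finset.sum_le_sum fun t _ => ?_
  by_cases hP : P t
  · simp [hP, h t hP]
  · simp [hP]

theorem weightOn_le_add {α : Type*} (f : α →₀ ℕ) {P Q R : α → Prop} (h : ∀ t, P t → Q t ∨ R t) :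
    weightOn f P ≤ weightOn f Q + weightOn f R := by
  classical
  unfold weightOn Finsupp.sum
  rw [← Finset.sum_add_distrib]
  refine Finset.sum_le_sum fun t _ => ?_
  by_cases hP : P t
  · rcases h t hP with h | h <;> simp [hP, h]
  · simp [hP]

theorem weightOn_congr {α : Type*} {f g : α →₀ ℕ} {P : α → Prop} (h : ∀ t, P t → f t = g t) :
    weightOn f P = weightOn g P := by
  classical
  unfold weightOn
  rw [Finsupp.sum_of_support_subset f (s := f.support ∪ g.support) Finset.subset_union_left _
      (by simp),
    Finsupp.sum_of_support_subset g (s := f.support ∪ g.support) Finset.subset_union_right _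
      (by simp)]
  refine Finset.sum_congr rfl fun t _ => ?_
  split_ifs with hP
  · exact h t hP
  · rfl

theorem exists_of_weightOn_ne_zero {α : Type*} {f : α →₀ ℕ} {P : α → Prop}
    (h : weightOn f P ≠ 0) : ∃ t, f t ≠ 0 ∧ P t := by
  classical
  obtain ⟨t, ht, h⟩ := Finset.exists_ne_zero_of_sum_ne_zero h
  refine ⟨t, Finsupp.mem_support_iff.1 ht, ?_⟩
  by_contra hP
  exact h (if_neg hP)

theorem marg_eq_weightOn {Attr Const : Type*} {X : Finset Attr} {n : ℕ}
    (f : KRelation ℕ Const X) (A : Fin n ↪ {x : Attr // x ∈ X}) (a : Fin n → Const) :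
    marg f A a = weightOn f fun t => (fun i => t (A i)) = a := by
  rw [marg, ← weightOn_eq, weightOn_mapDomain]

/-! ### Levels and extensions of tuples -/

/-- `q` extends `p` if it agrees with `p` wherever `p` is not `star`: the entries `star` of `p` are
read as wildcards. -/
def Extends {ι Const : Type*} (star : Const) (p q : ι → Const) : Prop :=
  ∀ x, p x ≠ star → q x = p x

open Classical in
/-- The level of a tuple is the number of its entries other than `star`. -/
noncomputable def level {ι Const : Type*} [Fintype ι] (star : Const) (p : ι → Const) : ℕ :=
  (Finset.univ.filter fun x => p x ≠ star).card

theorem Extends.refl {ι Const : Type*} (star : Const) (p : ι → Const) : Extends star p p :=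
  fun _ _ => rfl

theorem Extends.level_le {ι Const : Type*} [Fintype ι] {star : Const} {p q : ι → Const}
    (h : Extends star p q) : level star p ≤ level star q := by
  classical
  refine Finset.card_le_card fun x hx => ?_
  simp only [Finset.mem_filter, Finset.mem_univ, true_and] at hx ⊢
  rwa [h x hx]

theorem Extends.eq_or_level_lt {ι Const : Type*} [Fintype ι] {star : Const} {p q : ι → Const}
    (h : Extends star p q) : q = p ∨ level star p < level star q := by
  classical
  refine (Nat.eq_or_lt_of_le h.level_le).imp (fun he => ?_) id
  have hs : (Finset.univ.filter fun x => p x ≠ star) = Finset.univ.filter fun x => q x ≠ star := by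
    refine Finset.eq_of_subset_of_card_le (fun x hx => ?_) he.ge
    simp only [Finset.mem_filter, Finset.mem_univ, true_and] at hx ⊢
    rwa [h x hx]
  funext x
  by_cases hx : p x = star
  · have := Finset.ext_iff.1 hs x
    simp only [Finset.mem_filter, Finset.mem_univ, true_and, hx, ne_eq, not_true, false_iff,
      not_not] at this
    rw [this, hx]
  · exact h x hx

theorem level_le_card {ι Const : Type*} [Fintype ι] (star : Const) (p : ι → Const) :
    level star p ≤ Fintype.card ι := Finset.card_le_univ _

theorem level_comp_le {ι κ Const : Type*} [Fintype ι] [Fintype κ] (star : Const) (e : κ ↪ ι)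
    (p : ι → Const) : level star (fun i => p (e i)) ≤ level star p := by
  classical
  refine Finset.card_le_card_of_injOn e (fun i hi => ?_) e.injective.injOn
  simpa using hi

theorem padTuple_apply {Attr Const : Type*} {X : Finset Attr} {n : ℕ} (star : Const)
    (B : Fin n ↪ {x : Attr // x ∈ X}) (a : Fin n → Const) (i : Fin n) :
    padTuple star B a (B i) = a i := B.injective.extend_apply _ _ _

/-- Entries of a padded tuple other than `star` lie in the positions that have been filled. -/
theorem exists_of_padTuple_ne {Attr Const : Type*} {X : Finset Attr} {n : ℕ} {star : Const}
    {B : Fin n ↪ {x : Attr // x ∈ X}} {a : Fin n → Const} {x : {x : Attr // x ∈ X}}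
    (h : padTuple star B a x ≠ star) : ∃ i, B i = x := by
  by_contra hx
  exact h (Function.extend_apply' _ _ _ hx)

theorem level_padTuple {Attr Const : Type*} {X : Finset Attr} {n : ℕ} (star : Const)
    (B : Fin n ↪ {x : Attr // x ∈ X}) (a : Fin n → Const) :
    level star (padTuple star B a) = level star a := by
  classical
  unfold level
  symm
  refine Finset.card_bij (fun i _ => B i) (fun i hi => ?_) (fun i _ j _ h => B.injective h)
    (fun x hx => ?_)
  · simpa [padTuple_apply] using hi
  · simp only [Finset.mem_filter, Finset.mem_univ, true_and] at hx
    obtain ⟨i, rfl⟩ := exists_of_padTuple_ne hx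
    exact ⟨i, by simpa [padTuple_apply] using hx, rfl⟩

theorem extends_padTuple_iff {Attr Const : Type*} {X : Finset Attr} {n : ℕ} {star : Const}
    {B : Fin n ↪ {x : Attr // x ∈ X}} {a : Fin n → Const} {t : Tup Const X} :
    Extends star (padTuple star B a) t ↔ Extends star a fun i => t (B i) := by
  refine ⟨fun h i hi => ?_, fun h x hx => ?_⟩
  · have := h (B i)
    rw [padTuple_apply] at this
    exact this hi
  · obtain ⟨i, rfl⟩ := exists_of_padTuple_ne hx
    rw [padTuple_apply] at hx ⊢
    exact h i hx

theorem weightOn_extends_padTuple {Attr Const : Type*} {X : Finset Attr} {n : ℕ} (star : Const)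
    (f : KRelation ℕ Const X) (B : Fin n ↪ {x : Attr // x ∈ X}) (a : Fin n → Const) :
    weightOn f (Extends star (padTuple star B a)) =
      weightOn (f.mapDomain fun t i => t (B i)) (Extends star a) := by
  rw [weightOn_mapDomain]
  simp only [← extends_padTuple_iff]

theorem marg_le_weightOn_extends {Attr Const : Type*} {X : Finset Attr} {n : ℕ} (star : Const)
    (f : KRelation ℕ Const X) (B : Fin n ↪ {x : Attr // x ∈ X}) (a : Fin n → Const) :
    marg f B a ≤ weightOn f (Extends star (padTuple star B a)) := by
  rw [marg_eq_weightOn]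
  refine weightOn_mono _ fun t ht => extends_padTuple_iff.2 ?_
  rw [ht]
  exact Extends.refl _ _

theorem weightOn_extends_le {Attr Const : Type*} {X : Finset Attr} {n : ℕ} (star : Const)
    (f : KRelation ℕ Const X) (B : Fin n ↪ {x : Attr // x ∈ X}) (a : Fin n → Const) :
    weightOn f (Extends star (padTuple star B a)) ≤
      marg f B a + weightOn f fun t => level star a < level star t := by
  rw [marg_eq_weightOn]
  refine weightOn_le_add _ fun t ht => ?_
  exact (extends_padTuple_iff.1 ht).eq_or_level_lt.imp id
    fun h => h.trans_le (level_comp_le star B t)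

/-- If all marginals at tuples extending `a` agree, then so do the weights of the extensions
of the padded tuples. -/
theorem weightOn_extends_congr {Attr Const : Type*} {X Y : Finset Attr} {n : ℕ} {star : Const}
    {f : KRelation ℕ Const X} {g : KRelation ℕ Const Y} {A : Fin n ↪ {x : Attr // x ∈ X}}
    {B : Fin n ↪ {x : Attr // x ∈ Y}} {a : Fin n → Const}
    (h : ∀ b, Extends star a b → marg f A b = marg g B b) :
    weightOn f (Extends star (padTuple star A a)) =
      weightOn g (Extends star (padTuple star B a)) := by
  rw [weightOn_extends_padTuple, weightOn_extends_padTuple]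
  exact weightOn_congr h

/-! ### Chase steps -/

section ChaseStep

variable {Attr Rel Const : Type*} {att : Rel → Finset Attr} {Sch : Finset Rel} {star : Const}
  {D D' : KDatabase ℕ Const att Sch} {σ : IND att} {a : Fin σ.arity → Const}

theorem ChaseStep.marg_lt (h : ChaseStep star D D' σ a) :
    marg (D.rel σ.rhs) σ.B a < marg (D.rel σ.lhs) σ.A a := by
  have := h.1
  rwa [natLE_nat, not_le] at this

theorem ChaseStep.weightOn_rhs (h : ChaseStep star D D' σ a) (P : Tup Const (att σ.rhs) → Prop)
    [Decidable (P (padTuple star σ.B a))] :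
    weightOn (D'.rel σ.rhs) P = weightOn (D.rel σ.rhs) P +
      if P (padTuple star σ.B a) then marg (D.rel σ.lhs) σ.A a - marg (D.rel σ.rhs) σ.B a
      else 0 := by
  obtain ⟨_, c, hc, hr, _⟩ := h
  rw [hr, weightOn_add_single, ← hc, Nat.add_sub_cancel_left]

theorem ChaseStep.rel_eq (h : ChaseStep star D D' σ a) {S : Rel} (hS : S ≠ σ.rhs) :
    D'.rel S = D.rel S := by
  obtain ⟨_, c, _, _, hr⟩ := h
  exact hr S hS

theorem ChaseStep.weightOn_mono (h : ChaseStep star D D' σ a) (S : Rel)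
    (P : Tup Const (att S) → Prop) : weightOn (D.rel S) P ≤ weightOn (D'.rel S) P := by
  classical
  by_cases hS : S = σ.rhs
  · subst hS
    rw [h.weightOn_rhs]
    exact Nat.le_add_right _ _
  · rw [h.rel_eq hS]

/-- A chase step does not affect the weights of tuples of a higher level. -/
theorem ChaseStep.weightOn_of_level_lt (h : ChaseStep star D D' σ a) {S : Rel}
    {P : Tup Const (att S) → Prop} (hP : ∀ t, P t → level star a < level star t) :
    weightOn (D'.rel S) P = weightOn (D.rel S) P := by
  classical
  by_cases hS : S = σ.rhs
  · subst hS
    rw [h.weightOn_rhs, if_neg, add_zero]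
    intro hp
    have := hP _ hp
    rw [level_padTuple] at this
    exact this.false
  · rw [h.rel_eq hS]

theorem ChaseStep.lhs_mem (h : ChaseStep star D D' σ a) : σ.lhs ∈ Sch := by
  by_contra hS
  have := h.marg_lt
  rw [D.rel_eq_zero _ hS, marg_eq_weightOn (0 : KRelation ℕ Const (att σ.lhs)),
    weightOn_zero] at this
  exact Nat.not_lt_zero _ this

theorem ChaseStep.level_le (h : ChaseStep star D D' σ a) :
    level star a ≤ Sch.sup fun R => (att R).card :=
  calc level star a ≤ Fintype.card (Fin σ.arity) := level_le_card _ _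
    _ ≤ Fintype.card {x : Attr // x ∈ att σ.lhs} := Fintype.card_le_of_embedding σ.A
    _ = (att σ.lhs).card := Fintype.card_coe _
    _ ≤ _ := Finset.le_sup (f := fun R => (att R).card) h.lhs_mem

theorem ChaseStep.rhs_mem (h : ChaseStep star D D' σ a) : σ.rhs ∈ Sch := by
  classical
  by_contra hS
  have h₁ := h.weightOn_rhs fun _ => True
  rw [D.rel_eq_zero _ hS, D'.rel_eq_zero _ hS, weightOn_zero, if_pos trivial] at h₁
  have h₂ := h.marg_lt
  rw [D.rel_eq_zero _ hS] at h₂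
  omega

/-- The values of a tuple that gives rise to a chase step occur in the database. -/
theorem ChaseStep.exists_tuple (h : ChaseStep star D D' σ a) :
    ∃ t, D.rel σ.lhs t ≠ 0 ∧ (fun i => t (σ.A i)) = a := by
  have := h.marg_lt
  rw [marg_eq_weightOn (D.rel σ.lhs)] at this
  exact exists_of_weightOn_ne_zero (by omega)

/-- The tuples of positive weight after a chase step are old ones and the padded tuple. -/
theorem ChaseStep.ne_zero_cases (h : ChaseStep star D D' σ a)
    {p : ∀ S, Tup Const (att S) → Prop} (hD : ∀ S t, D.rel S t ≠ 0 → p S t)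
    (ha : p σ.rhs (padTuple star σ.B a)) {S : Rel} {t : Tup Const (att S)}
    (ht : D'.rel S t ≠ 0) : p S t := by
  classical
  by_cases hS : S = σ.rhs
  · subst hS
    rw [← weightOn_eq, h.weightOn_rhs, weightOn_eq] at ht
    by_cases hp : padTuple star σ.B a = t
    · exact hp ▸ ha
    · rw [if_neg hp, add_zero] at ht
      exact hD _ _ ht
  · rw [h.rel_eq hS] at ht
    exact hD _ _ ht

end ChaseStep

/-! ### The preorder of relation names -/

section Reaches

variable {Attr Rel : Type*} {att : Rel → Finset Attr}

/-- The preorder on relation names given by the derivable dependencies `R[∅] ≤ S[∅]`. By weak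
symmetry, the dependencies between equivalent relation names are symmetric. -/
def Reaches (Γ : Set (IND att)) (R S : Rel) : Prop :=
  DerivesWS Γ ⟨R, S, 0, Function.Embedding.ofIsEmpty, Function.Embedding.ofIsEmpty⟩

theorem Reaches.refl (Γ : Set (IND att)) (R : Rel) : Reaches Γ R R := DerivesWS.refl _ _ _

theorem Reaches.trans {Γ : Set (IND att)} {R S T : Rel} (h₁ : Reaches Γ R S)
    (h₂ : Reaches Γ S T) : Reaches Γ R T := DerivesWS.trans h₁ h₂

theorem DerivesWS.reaches {Γ : Set (IND att)} {σ : IND att} (h : DerivesWS Γ σ) :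
    Reaches Γ σ.lhs σ.rhs := by
  have := DerivesWS.proj 0 Function.Embedding.ofIsEmpty h
  unfold Reaches
  convert this using 2 <;> exact Subsingleton.elim _ _

open Classical in
/-- The number of relation names in the schema from which `S` can be reached. -/
noncomputable def height (Γ : Set (IND att)) (Sch : Finset Rel) (S : Rel) : ℕ :=
  (Sch.filter fun T => Reaches Γ T S).card

theorem Reaches.height_le {Γ : Set (IND att)} {R S : Rel} (h : Reaches Γ R S) (Sch : Finset Rel) :
    height Γ Sch R ≤ height Γ Sch S := by
  classical
  exact Finset.card_le_card (Finset.monotone_filter_right _ fun T _ hT => hT.trans h)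

theorem Reaches.height_lt {Γ : Set (IND att)} {R S : Rel} (h : Reaches Γ R S)
    (h' : ¬ Reaches Γ S R) {Sch : Finset Rel} (hS : S ∈ Sch) :
    height Γ Sch R < height Γ Sch S := by
  classical
  refine Finset.card_lt_card (Finset.ssubset_iff_of_subset
    (Finset.monotone_filter_right _ fun T _ hT => hT.trans h) |>.2 ⟨S, ?_, ?_⟩)
  · exact Finset.mem_filter.2 ⟨hS, Reaches.refl _ _⟩
  · exact fun hm => h' (Finset.mem_filter.1 hm).2

theorem DerivesWS.over_or_eq {Γ : Set (IND att)} {Sch : Finset Rel} (hΓ : ∀ σ ∈ Γ, σ.Over Sch)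
    {σ : IND att} (h : DerivesWS Γ σ) : σ.lhs = σ.rhs ∨ σ.Over Sch := by
  induction h with
  | hyp h => exact Or.inr (hΓ _ h)
  | refl => exact Or.inl rfl
  | trans _ _ h₁ h₂ =>
    simp only [IND.Over] at *
    rcases h₁ with rfl | h₁ <;> rcases h₂ with rfl | h₂ <;> simp_all
  | proj _ _ _ h => exact h
  | weakSymm _ _ h _ => exact h.imp Eq.symm And.symm

end Reaches

/-! ### Termination of the chase -/

section Termination

variable {Attr Rel Const : Type*} {att : Rel → Finset Attr} {Sch : Finset Rel} {star : Const}
  {Γ : Set (IND att)} {s : ℕ → KDatabase ℕ Const att Sch} {σ : ℕ → IND att}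
  {a : ∀ i, Fin (σ i).arity → Const}

/-- `D` satisfies all instances above level `m` of dependencies derivable from `Γ`. -/
def ClosedAbove (star : Const) (Γ : Set (IND att)) (m : ℕ) (D : KDatabase ℕ Const att Sch) :
    Prop :=
  ∀ σ, DerivesWS Γ σ → ∀ b : Fin σ.arity → Const, m < level star b →
    marg (D.rel σ.lhs) σ.A b ≤ marg (D.rel σ.rhs) σ.B b

theorem weightOn_const_of_level_le (hs : ∀ i, ChaseStep star (s i) (s (i + 1)) (σ i) (a i))
    {m N : ℕ} (hm : ∀ i, N ≤ i → level star (a i) ≤ m) {i : ℕ} (hi : N ≤ i) {S : Rel}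
    {P : Tup Const (att S) → Prop} (hP : ∀ t, P t → m < level star t) :
    weightOn ((s i).rel S) P = weightOn ((s N).rel S) P := by
  induction i, hi using Nat.le_induction with
  | base => rfl
  | succ i hi ih =>
    rw [← ih]
    exact (hs i).weightOn_of_level_lt fun t ht => (hm i hi).trans_lt (hP t ht)

theorem marg_const_of_level_le (hs : ∀ i, ChaseStep star (s i) (s (i + 1)) (σ i) (a i))
    {m N : ℕ} (hm : ∀ i, N ≤ i → level star (a i) ≤ m) {i : ℕ} (hi : N ≤ i) {S : Rel} {n : ℕ}
    (B : Fin n ↪ {x : Attr // x ∈ att S}) {b : Fin n → Const} (hb : m < level star b) :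
    marg ((s i).rel S) B b = marg ((s N).rel S) B b := by
  rw [marg_eq_weightOn, marg_eq_weightOn]
  refine weightOn_const_of_level_le hs hm hi fun t ht => ?_
  rw [← ht] at hb
  exact hb.trans_le (level_comp_le star B t)

theorem ClosedAbove.of_le (hs : ∀ i, ChaseStep star (s i) (s (i + 1)) (σ i) (a i))
    {m N : ℕ} (hm : ∀ i, N ≤ i → level star (a i) ≤ m) {i : ℕ} (hi : N ≤ i)
    (h : ClosedAbove star Γ m (s N)) : ClosedAbove star Γ m (s i) := by
  intro τ hτ b hb
  rw [marg_const_of_level_le hs hm hi _ hb, marg_const_of_level_le hs hm hi _ hb]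
  exact h τ hτ b hb

/-- Once all steps have level at most `m` and all instances above level `m` are closed, the weight
of the extensions of a tuple `p` of level `m` stays bounded: a step along a dependency between
equivalent relation names only copies such a weight from the left-hand side, since by weak symmetry
the marginals above level `m` agree on both sides; any other step increases the height, and exceeds
the weight on the left-hand side at most by the weight of the tuples above level `m`, which does not
change any more. -/
theorem weightOn_extends_bounded (hσ : ∀ i, DerivesWS Γ (σ i))
    (hs : ∀ i, ChaseStep star (s i) (s (i + 1)) (σ i) (a i))
    {m N C : ℕ} (hm : ∀ i, N ≤ i → level star (a i) ≤ m) (hN : ClosedAbove star Γ m (s N))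
    (hC : ∀ S, weightOn ((s N).rel S) (fun _ => True) ≤ C) {i : ℕ} (hi : N ≤ i) (S : Rel)
    (p : Tup Const (att S)) (hp : level star p = m) :
    weightOn ((s i).rel S) (Extends star p) ≤ C * (1 + height Γ Sch S) := by
  classical
  induction i, hi using Nat.le_induction generalizing S with
  | base =>
    calc _ ≤ C := (weightOn_mono _ fun _ _ => trivial).trans (hC S)
      _ ≤ _ := Nat.le_mul_of_pos_right _ (by omega)
  | succ i hi ih =>
    have hst := hs i
    by_cases hS : S = (σ i).rhs
    swap
    · rw [hst.rel_eq hS]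
      exact ih S p hp
    subst hS
    by_cases hpe : Extends star p (padTuple star (σ i).B (a i))
    swap
    · rw [hst.weightOn_rhs, if_neg hpe, add_zero]
      exact ih _ p hp
    have hpad : padTuple star (σ i).B (a i) = p := by
      refine hpe.eq_or_level_lt.resolve_right fun hlt => ?_
      rw [level_padTuple, hp] at hlt
      exact (hm i hi).not_gt hlt
    have ham : level star (a i) = m := by rw [← hp, ← hpad, level_padTuple]
    -- the new marginal on the right-hand side is the old one on the left-hand side
    have hnew : marg ((s (i + 1)).rel (σ i).rhs) (σ i).B (a i) =
        marg ((s i).rel (σ i).lhs) (σ i).A (a i) := by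
      rw [marg_eq_weightOn, hst.weightOn_rhs, if_pos (funext (padTuple_apply star _ _)),
        ← marg_eq_weightOn]
      exact Nat.add_sub_cancel' hst.marg_lt.le
    have hA : weightOn ((s i).rel (σ i).lhs) (Extends star (padTuple star (σ i).A (a i))) ≤
        C * (1 + height Γ Sch (σ i).lhs) := ih _ _ ((level_padTuple _ _ _).trans ham)
    have hreach := (hσ i).reaches
    rw [← hpad]
    by_cases hback : Reaches Γ (σ i).rhs (σ i).lhs
    · refine le_trans (le_of_eq ?_) (hA.trans (Nat.mul_le_mul_left _
        (Nat.add_le_add_left (hreach.height_le Sch) _)))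
      refine weightOn_extends_congr fun b hb => ?_
      rcases hb.eq_or_level_lt with rfl | hlt
      · exact hnew
      · rw [ham] at hlt
        have hcl := hN.of_le hs hm hi
        rw [marg_const_of_level_le hs hm (hi.trans i.le_succ) _ hlt,
          ← marg_const_of_level_le hs hm hi _ hlt]
        exact le_antisymm (hcl _ (DerivesWS.weakSymm (hσ i) hback) b hlt) (hcl _ (hσ i) b hlt)
    · have hlt := hreach.height_lt hback hst.rhs_mem
      have h₁ := weightOn_extends_le star ((s (i + 1)).rel (σ i).rhs) (σ i).B (a i)
      have h₂ : weightOn ((s (i + 1)).rel (σ i).rhs) (fun t => level star (a i) < level star t) ≤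
          C := by
        rw [weightOn_const_of_level_le hs hm (hi.trans i.le_succ) fun t ht => ham ▸ ht]
        exact (weightOn_mono _ fun _ _ => trivial).trans (hC _)
      have h₃ := marg_le_weightOn_extends star ((s i).rel (σ i).lhs) (σ i).A (a i)
      calc _ ≤ C * (1 + height Γ Sch (σ i).lhs) + C := by omega
        _ = C * (1 + (height Γ Sch (σ i).lhs + 1)) := by ring
        _ ≤ _ := Nat.mul_le_mul_left _ (Nat.add_le_add_left hlt _)

/-- All values of tuples of positive weight in `D` belong to `F`. -/
def ValuesIn (F : Finset Const) (D : KDatabase ℕ Const att Sch) : Prop :=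
  ∀ S t, D.rel S t ≠ 0 → ∀ x, t x ∈ F

theorem exists_valuesIn (D : KDatabase ℕ Const att Sch) (star : Const) :
    ∃ F, star ∈ F ∧ ValuesIn F D := by
  classical
  refine ⟨insert star (Sch.biUnion fun S => (D.rel S).support.biUnion fun t =>
    Finset.univ.image t), Finset.mem_insert_self _ _, fun S t ht x => ?_⟩
  refine Finset.mem_insert_of_mem (Finset.mem_biUnion.2 ⟨S, ?_, Finset.mem_biUnion.2
    ⟨t, Finsupp.mem_support_iff.2 ht, Finset.mem_image_of_mem _ (Finset.mem_univ _)⟩⟩)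
  by_contra hS
  exact ht (by rw [D.rel_eq_zero _ hS]; rfl)

theorem padTuple_mem {X : Finset Attr} {F : Finset Const} (hF : star ∈ F) {n : ℕ}
    (B : Fin n ↪ {x : Attr // x ∈ X}) {b : Fin n → Const} (hb : ∀ i, b i ∈ F)
    (x : {x : Attr // x ∈ X}) : padTuple star B b x ∈ F := by
  by_cases hx : padTuple star B b x = star
  · rwa [hx]
  · obtain ⟨i, rfl⟩ := exists_of_padTuple_ne hx
    rw [padTuple_apply]
    exact hb i

theorem ChaseStep.value_mem {D D' : KDatabase ℕ Const att Sch} {σ : IND att}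
    {a : Fin σ.arity → Const} (h : ChaseStep star D D' σ a) {F : Finset Const}
    (hD : ValuesIn F D) (i : Fin σ.arity) : a i ∈ F := by
  obtain ⟨t, ht, rfl⟩ := h.exists_tuple
  exact hD _ _ ht _

theorem ValuesIn.chaseStep {D D' : KDatabase ℕ Const att Sch} {σ : IND att}
    {a : Fin σ.arity → Const} {F : Finset Const} (hF : star ∈ F)
    (hD : ValuesIn F D) (h : ChaseStep star D D' σ a) : ValuesIn F D' :=
  fun _ _ ht => h.ne_zero_cases (p := fun _ t => ∀ x, t x ∈ F) hD
    (padTuple_mem hF _ (h.value_mem hD)) ht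

theorem not_frequently_lt_of_bounded {f : ℕ → ℕ} (hf : Monotone f) {C : ℕ} (hC : ∀ i, f i ≤ C)
    (h : ∃ᶠ i in Filter.atTop, f i < f (i + 1)) : False := by
  have key : ∀ k, ∃ i, k ≤ f i := by
    intro k
    induction k with
    | zero => exact ⟨0, Nat.zero_le _⟩
    | succ k ih =>
      obtain ⟨i, hi⟩ := ih
      obtain ⟨j, hij, hj⟩ := Filter.frequently_atTop.1 h i
      exact ⟨j + 1, (hi.trans (hf hij)).trans_lt hj⟩
  obtain ⟨i, hi⟩ := key (C + 1)
  exact (hC i).not_gt hi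

/-- There is no infinite sequence of chase steps in which, for the largest level `m` that occurs
infinitely often, the instances above level `m` are eventually closed: the total weight of the
tuples of level `m` would have to be bounded. -/
theorem not_forall_chaseStep (hσ : ∀ i, DerivesWS Γ (σ i))
    (hs : ∀ i, ChaseStep star (s i) (s (i + 1)) (σ i) (a i))
    (hclosed : ∀ m N, (∀ i, N ≤ i → level star (a i) ≤ m) →
      (∃ i, N ≤ i ∧ level star (a i) = m) → ∃ i, N ≤ i ∧ ClosedAbove star Γ m (s i)) : False := by
  classical
  have hbdd : ∃ m, ∀ᶠ i in Filter.atTop, level star (a i) ≤ m :=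
    ⟨_, Filter.Eventually.of_forall fun i => (hs i).level_le⟩
  obtain ⟨m, hm, hmin⟩ : ∃ m, (∀ᶠ i in Filter.atTop, level star (a i) ≤ m) ∧
      ∀ k < m, ¬ ∀ᶠ i in Filter.atTop, level star (a i) ≤ k :=
    ⟨Nat.find hbdd, Nat.find_spec hbdd, fun k hk => Nat.find_min hbdd hk⟩
  have hfreq : ∃ᶠ i in Filter.atTop, level star (a i) = m := by
    intro hne
    have hlt := hm.and hne
    rcases m with _ | k
    · obtain ⟨i, h₁, h₂⟩ := hlt.exists
      omega
    · exact hmin k k.lt_succ_self (hlt.mono fun i hi => by omega)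
  obtain ⟨N₀, hN₀⟩ := Filter.eventually_atTop.1 hm
  obtain ⟨N, hNN, hN⟩ := hclosed m N₀ hN₀ (Filter.frequently_atTop.1 hfreq N₀)
  have hm' : ∀ i, N ≤ i → level star (a i) ≤ m := fun i hi => hN₀ i (hNN.trans hi)
  obtain ⟨C, hC⟩ : ∃ C, ∀ S, weightOn ((s N).rel S) (fun _ => True) ≤ C := by
    refine ⟨Sch.sup fun S => weightOn ((s N).rel S) fun _ => True, fun S => ?_⟩
    by_cases hS : S ∈ Sch
    · exact Finset.le_sup (f := fun S => weightOn ((s N).rel S) fun _ => True) hS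
    · rw [(s N).rel_eq_zero _ hS, weightOn_zero]
      exact Nat.zero_le _
  obtain ⟨F, hF, hF₀⟩ := exists_valuesIn (s 0) star
  have hFi : ∀ i, ValuesIn F (s i) := by
    intro i
    induction i with
    | zero => exact hF₀
    | succ i ih => exact ih.chaseStep hF (hs i)
  -- the total weight of the tuples of level `m` with values in `F`
  let patterns : ∀ S : Rel, Finset (Tup Const (att S)) := fun S =>
    (Fintype.piFinset fun _ => F).filter fun p => level star p = m
  let Φ : ℕ → ℕ := fun i => ∑ S ∈ Sch, ∑ p ∈ patterns S, weightOn ((s i).rel S) (· = p)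
  have hmono : ∀ i S, ∑ p ∈ patterns S, weightOn ((s i).rel S) (· = p) ≤
      ∑ p ∈ patterns S, weightOn ((s (i + 1)).rel S) (· = p) :=
    fun i S => Finset.sum_le_sum fun p _ => (hs i).weightOn_mono S _
  have hΦ : Monotone Φ := monotone_nat_of_le_succ fun i => Finset.sum_le_sum fun S _ => hmono i S
  have hΦC : ∀ i, Φ i ≤ ∑ S ∈ Sch, ∑ p ∈ patterns S, C * (1 + height Γ Sch S) := by
    intro i
    refine (hΦ (Nat.le_max_right N i)).trans
      (Finset.sum_le_sum fun S _ => Finset.sum_le_sum fun p hp => ?_)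
    refine le_trans (weightOn_mono _ ?_) (weightOn_extends_bounded hσ hs hm' hN hC
      (Nat.le_max_left N i) S p (Finset.mem_filter.1 hp).2)
    rintro t rfl
    exact Extends.refl _ _
  refine not_frequently_lt_of_bounded hΦ hΦC (hfreq.mono fun i hi => ?_)
  have hst := hs i
  refine Finset.sum_lt_sum (fun S _ => hmono i S) ⟨(σ i).rhs, hst.rhs_mem, ?_⟩
  refine Finset.sum_lt_sum (fun p _ => hst.weightOn_mono _ _)
    ⟨padTuple star (σ i).B (a i), Finset.mem_filter.2 ⟨Fintype.mem_piFinset.2 ?_, ?_⟩, ?_⟩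
  · exact padTuple_mem hF _ (hst.value_mem (hFi i))
  · rw [level_padTuple, hi]
  · rw [hst.weightOn_rhs, if_pos rfl]
    have := hst.marg_lt
    omega

/-- The chase by the closure of `Γ` terminates on every `ℕ`-database: in an infinite chase sequence,
fairness closes all instances above the largest level that occurs infinitely often. -/
theorem chaseTerminates_wsClosure (star : Const) (Γ : Set (IND att))
    (D : KDatabase ℕ Const att Sch) : ChaseTerminates star (wsClosure Γ) D := by
  rintro ⟨s, -, hstep, hfair⟩
  choose σ hσ a hs using hstep
  refine not_forall_chaseStep hσ hs fun m N hm _ => ⟨N, le_rfl, fun τ hτ b hb => ?_⟩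
  obtain ⟨j, hj, hle⟩ := hfair N τ hτ b
  rwa [natLE_nat, marg_const_of_level_le hs hm hj.le _ hb] at hle

end Termination

/-! ### Existence of a result -/

section Results

variable {Attr Rel Const : Type*} {att : Rel → Finset Attr} {Sch : Finset Rel} {star : Const}
  {Γ : Set (IND att)}

theorem exists_chaseStep (D : KDatabase ℕ Const att Sch) {σ : IND att} (hσ : σ.rhs ∈ Sch)
    {a : Fin σ.arity → Const}
    (h : marg (D.rel σ.rhs) σ.B a < marg (D.rel σ.lhs) σ.A a) :
    ∃ D', ChaseStep star D D' σ a := by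
  classical
  refine ⟨⟨Function.update D.rel σ.rhs (D.rel σ.rhs + Finsupp.single (padTuple star σ.B a)
    (marg (D.rel σ.lhs) σ.A a - marg (D.rel σ.rhs) σ.B a)), fun R hR => ?_⟩, ?_, _,
    Nat.add_sub_cancel' h.le, ?_, fun U hU => ?_⟩
  · rw [Function.update_of_ne (fun e => hR (by rwa [e])), D.rel_eq_zero R hR]
  · rwa [natLE_nat, not_le]
  · exact Function.update_self (f := D.rel) ..
  · exact Function.update_of_ne hU _ D.rel

/-- If `D` violates a dependency of the closure of `Γ`, then there is a chase step at an instance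
of maximal level among the violated ones. -/
theorem exists_chaseStep_closedAbove (star : Const) (hΓ : ∀ σ ∈ Γ, σ.Over Sch)
    {D : KDatabase ℕ Const att Sch} (hD : ¬ ∀ σ ∈ wsClosure Γ, D.Satisfies σ) :
    ∃ D' : KDatabase ℕ Const att Sch, ∃ σ, DerivesWS Γ σ ∧ ∃ a : Fin σ.arity → Const,
      ChaseStep star D D' σ a ∧ ClosedAbove star Γ (level star a) D := by
  classical
  have hstep : ∀ σ, DerivesWS Γ σ → ∀ a : Fin σ.arity → Const,
      marg (D.rel σ.rhs) σ.B a < marg (D.rel σ.lhs) σ.A a → ∃ D', ChaseStep star D D' σ a := by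
    intro σ hσ a ha
    refine exists_chaseStep D ?_ ha
    rcases hσ.over_or_eq hΓ with he | ho
    · rw [← he]
      by_contra hS
      rw [D.rel_eq_zero _ hS, marg_eq_weightOn (0 : KRelation ℕ Const (att σ.lhs)),
        weightOn_zero] at ha
      exact Nat.not_lt_zero _ ha
    · exact ho.2
  let V : ℕ → Prop := fun k => ∃ σ, DerivesWS Γ σ ∧ ∃ a : Fin σ.arity → Const,
    level star a = k ∧ marg (D.rel σ.rhs) σ.B a < marg (D.rel σ.lhs) σ.A a
  have hbound : ∀ k, V k → k ≤ Sch.sup fun R => (att R).card := by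
    rintro k ⟨σ, hσ, a, rfl, ha⟩
    obtain ⟨D', h⟩ := hstep σ hσ a ha
    exact h.level_le
  have hex : ∃ k, V k := by
    by_contra hno
    refine hD fun σ hσ a => natLE_nat.2 (not_lt.1 fun hlt => hno ⟨_, σ, hσ, a, rfl, hlt⟩)
  obtain ⟨k, hk⟩ := hex
  have hmax := Nat.findGreatest_spec (hbound k hk) hk
  obtain ⟨σ, hσ, a, hl, ha⟩ := hmax
  obtain ⟨D', h⟩ := hstep σ hσ a ha
  refine ⟨D', σ, hσ, a, h, fun τ hτ b hb => not_lt.1 fun hlt => ?_⟩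
  have hV : V (level star b) := ⟨τ, hτ, b, rfl, hlt⟩
  exact (Nat.le_findGreatest (hbound _ hV) hV).not_gt (hl ▸ hb)

/-- The chase that always closes a violated instance of maximal level ends with a result. -/
theorem exists_isChaseResult (star : Const) (hΓ : ∀ σ ∈ Γ, σ.Over Sch)
    (D : KDatabase ℕ Const att Sch) : ∃ E, IsChaseResult star (wsClosure Γ) D E := by
  classical
  have hnext : ∀ D : KDatabase ℕ Const att Sch, ∃ D', (¬ ∀ σ ∈ wsClosure Γ, D.Satisfies σ) →
      ∃ σ, DerivesWS Γ σ ∧ ∃ a : Fin σ.arity → Const,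
        ChaseStep star D D' σ a ∧ ClosedAbove star Γ (level star a) D := by
    intro D
    by_cases hD : ∀ σ ∈ wsClosure Γ, D.Satisfies σ
    · exact ⟨D, fun h => absurd hD h⟩
    · obtain ⟨D', h⟩ := exists_chaseStep_closedAbove star hΓ hD
      exact ⟨D', fun _ => h⟩
  choose next hnext using hnext
  let s : ℕ → KDatabase ℕ Const att Sch := fun i => Nat.rec D (fun _ => next) i
  have hend : ∃ n, ∀ σ ∈ wsClosure Γ, (s n).Satisfies σ := by
    by_contra! hno
    have hstep : ∀ i, ∃ σ, DerivesWS Γ σ ∧ ∃ a : Fin σ.arity → Const,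
        ChaseStep star (s i) (s (i + 1)) σ a ∧ ClosedAbove star Γ (level star a) (s i) := by
      intro i
      refine hnext (s i) fun h => ?_
      obtain ⟨σ, hσ, hns⟩ := hno i
      exact hns (h σ hσ)
    choose σ hσ a hs hc using hstep
    refine not_forall_chaseStep hσ hs fun m N _ ⟨i, hi, hm⟩ => ⟨i, hi, ?_⟩
    exact hm ▸ hc i
  refine ⟨s (Nat.find hend), Nat.find hend, fun i => s i, ⟨rfl, fun i => ?_, ?_⟩, ?_⟩
  · obtain ⟨σ, hσ, a, hs, -⟩ := hnext (s i) (Nat.find_min hend i.isLt)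
    exact ⟨σ, hσ, a, hs⟩
  · simpa using Nat.find_spec hend
  · simp

end Results

/-! ### Derivability from a result of the chase -/

section Completeness

variable {Attr Rel Const : Type*} {att : Rel → Finset Attr} {Sch : Finset Rel} {star : Const}
  {Γ : Set (IND att)}

/-- The provenance of the tuples in the chase of the canonical database of `τ`: wherever a tuple of
`S` of positive weight has the entries `j₁, …, jₘ` at `B₁, …, Bₘ`, the dependency
`R[A_{j₁}, …, A_{jₘ}] ≤ S[B₁, …, Bₘ]` is derivable, where `R[A]` is the left-hand side of `τ`. -/
def Traced (Γ : Set (IND att)) (num : ℕ → Const) (τ : IND att)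
    (D : KDatabase ℕ Const att Sch) : Prop :=
  ∀ S t, D.rel S t ≠ 0 → ∀ (m : ℕ) (B : Fin m ↪ {x : Attr // x ∈ att S})
    (j : Fin m ↪ Fin τ.arity), (∀ i, t (B i) = num ((j i : ℕ) + 1)) →
      DerivesWS Γ ⟨τ.lhs, S, m, j.trans τ.A, B⟩

theorem traced_canonicalDB (Γ : Set (IND att)) (num : ℕ ↪ Const) (τ : IND att)
    (hstar : ∀ i ∈ Finset.Icc 1 τ.arity, num i ≠ star) (hτ : τ.lhs ∈ Sch) :
    Traced Γ num τ (canonicalDB Sch num star τ hτ) := by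
  classical
  intro S t ht m B j hj
  by_cases hS : S = τ.lhs
  swap
  · exact absurd (by simp [canonicalDB, Pi.single_eq_of_ne hS]) ht
  subst hS
  have htp : padTuple star τ.A (fun i => num ((i : ℕ) + 1)) = t := by
    by_contra hne
    exact ht (by simp [canonicalDB, Finsupp.single_eq_of_ne' hne])
  subst htp
  have hB : B = j.trans τ.A := by
    ext1 i
    have hne : padTuple star τ.A (fun i => num ((i : ℕ) + 1)) (B i) ≠ star := by
      rw [hj i]
      exact hstar _ (Finset.mem_Icc.2 ⟨by omega, (j i).isLt⟩)
    obtain ⟨k, hk⟩ := exists_of_padTuple_ne hne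
    have h := hj i
    rw [← hk, padTuple_apply] at h
    have hkj : k = j i := Fin.ext (Nat.succ_injective (num.injective h))
    rw [← hk, hkj]
    rfl
  rw [hB]
  exact DerivesWS.refl _ _ _

theorem Traced.chaseStep {num : ℕ → Const} {τ : IND att}
    (hstar : ∀ i ∈ Finset.Icc 1 τ.arity, num i ≠ star) {D D' : KDatabase ℕ Const att Sch}
    (hD : Traced Γ num τ D) {σ : IND att} (hσ : DerivesWS Γ σ) {a : Fin σ.arity → Const}
    (h : ChaseStep star D D' σ a) : Traced Γ num τ D' := by
  intro S t ht
  refine h.ne_zero_cases (p := fun S t => ∀ (m : ℕ) (B : Fin m ↪ {x : Attr // x ∈ att S})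
    (j : Fin m ↪ Fin τ.arity), (∀ i, t (B i) = num ((j i : ℕ) + 1)) →
      DerivesWS Γ ⟨τ.lhs, S, m, j.trans τ.A, B⟩) hD ?_ ht
  intro m B j hj
  obtain ⟨u, hu, rfl⟩ := h.exists_tuple
  have hB : ∀ i, ∃ k, σ.B k = B i := fun i => exists_of_padTuple_ne (by
    rw [hj i]
    exact hstar _ (Finset.mem_Icc.2 ⟨by omega, (j i).isLt⟩))
  choose k hk using hB
  have hkinj : Function.Injective k := fun x y hxy => B.injective (by rw [← hk, ← hk, hxy])
  obtain rfl : B = (⟨k, hkinj⟩ : Fin m ↪ Fin σ.arity).trans σ.B := by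
    ext1 i
    exact (hk i).symm
  refine DerivesWS.trans (hD σ.lhs u hu m ((⟨k, hkinj⟩ : Fin m ↪ Fin σ.arity).trans σ.A) j
    fun i => ?_) (DerivesWS.proj m ⟨k, hkinj⟩ hσ)
  rw [← hj i, ← hk i, padTuple_apply]
  rfl

/-- Properties preserved by chase steps pass to the results of the chase. -/
theorem IsChaseResult.induction {Δ : Set (IND att)} {D E : KDatabase ℕ Const att Sch}
    (h : IsChaseResult star Δ D E) {p : KDatabase ℕ Const att Sch → Prop} (hD : p D)
    (hstep : ∀ D D', p D → ∀ σ ∈ Δ, ∀ a, ChaseStep star D D' σ a → p D') : p E := by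
  obtain ⟨n, s, hs, rfl⟩ := h
  have key : ∀ i : Fin (n + 1), p (s i) := by
    intro i
    induction i using Fin.induction with
    | zero => rw [hs.start]; exact hD
    | succ i ih =>
      obtain ⟨σ, hσ, a, hc⟩ := hs.step i
      exact hstep _ _ ih σ hσ a hc
  exact key _

theorem IsChaseResult.satisfies {Δ : Set (IND att)} {D E : KDatabase ℕ Const att Sch}
    (h : IsChaseResult star Δ D E) {σ : IND att} (hσ : σ ∈ Δ) : E.Satisfies σ := by
  obtain ⟨n, s, hs, rfl⟩ := h
  exact hs.closed σ hσ

/-- A result `E` of the chase that satisfies `τ` has a tuple of the right-hand side of `τ` with the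
entries `1, …, n`, whose provenance is a derivation of `τ`. -/
theorem IsChaseResult.derives {num : ℕ ↪ Const} {τ : IND att}
    (hstar : ∀ i ∈ Finset.Icc 1 τ.arity, num i ≠ star) (hτ : τ.lhs ∈ Sch)
    {E : KDatabase ℕ Const att Sch}
    (h : IsChaseResult star (wsClosure Γ) (canonicalDB Sch num star τ hτ) E)
    (hE : E.Satisfies τ) : DerivesWS Γ τ := by
  classical
  have htr : Traced Γ num τ E := h.induction (traced_canonicalDB Γ num τ hstar hτ)
    fun _ _ hD σ hσ _ hc => hD.chaseStep hstar hσ hc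
  have hpos : 1 ≤ weightOn (E.rel τ.lhs)
      (fun t => (fun i => t (τ.A i)) = fun i : Fin τ.arity => num ((i : ℕ) + 1)) := by
    refine h.induction (p := fun D => 1 ≤ weightOn (D.rel τ.lhs) _) ?_
      fun _ _ hD _ _ _ hc => hD.trans (hc.weightOn_mono _ _)
    have : (canonicalDB Sch num star τ hτ).rel τ.lhs =
        0 + Finsupp.single (padTuple star τ.A fun i => num ((i : ℕ) + 1)) 1 := by
      simp [canonicalDB]
    rw [this, weightOn_add_single, if_pos (funext (padTuple_apply star _ _))]
    exact Nat.le_add_left _ _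
  have hle := natLE_nat.1 (hE fun i => num ((i : ℕ) + 1))
  rw [marg_eq_weightOn, marg_eq_weightOn] at hle
  obtain ⟨t, ht, htB⟩ := exists_of_weightOn_ne_zero (Nat.pos_iff_ne_zero.1 (hpos.trans hle))
  exact htr _ t ht _ τ.B (Function.Embedding.refl _) (congrFun htB)

end Completeness

/-! ### Equivalence of derivability, entailment and the chase -/

theorem mainTheorem3 {Attr Rel Const K : Type*} [AddCommMonoid K] [Nontrivial K]
    (hpos : PositiveMonoid K) (hwc : WeaklyCancellative K)
    (att : Rel → Finset Attr) (num : ℕ ↪ Const) (star : Const)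
    (Γ : Set (IND att)) (hΓ : Γ.Finite) (τ : IND att)
    (hstar : ∀ i ∈ Finset.Icc 1 τ.arity, num i ≠ star)
    (Sch : Finset Rel) (hΓS : ∀ σ ∈ Γ, σ.Over Sch) (hτS : τ.Over Sch) :
    ChaseTerminates star (wsClosure Γ) (canonicalDB Sch num star τ hτS.1) ∧
    (∃ E, IsChaseResult star (wsClosure Γ) (canonicalDB Sch num star τ hτS.1) E) ∧
    ∀ E, IsChaseResult star (wsClosure Γ) (canonicalDB Sch num star τ hτS.1) E →
      List.TFAE [DerivesWS Γ τ, Entails K Const Γ τ, E.Satisfies τ] := by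
  refine ⟨chaseTerminates_wsClosure star Γ _, exists_isChaseResult star hΓS _, fun E hE => ?_⟩
  tfae_have 1 → 2 := fun h _ _ _ _ hD => h.sound hpos hwc hD
  tfae_have 2 → 3 := by
    intro h
    obtain ⟨k, hk⟩ := exists_ne (0 : K)
    refine (E.smulBy_satisfies_iff hpos hwc hk τ).1 (h Sch hΓS hτS _ fun σ hσ => ?_)
    exact (E.smulBy_satisfies_iff hpos hwc hk σ).2 (hE.satisfies (DerivesWS.hyp hσ))
  tfae_have 3 → 1 := hE.derives hstar hτS.1
  tfae_finish
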